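/- Let $\mathbb F=\mathbb R$ or $\mathbb C$ and let $m$ be a positive even integer. Put $d_{\mathbb R}(m)=\frac{(m+2)(m-1)}2$, $d_{\mathbb C}(m)=m^2-1$, $k_{\mathbb R}(m)=\frac m2+1$, $k_{\mathbb C}(m)=m+1$. An $(n,l,m)$-fusion frame is a collection $\{P_j\}_{j=1}^n$ of orthogonal projections onto $l$-dimensional subspaces of $\mathbb F^m$ for which there are constants $0<A\le B$ with $A\|x\|^2\le\sum_{j=1}^n\|P_jx\|^2\le B\|x\|^2$ for all $x\in\mathbb F^m$. It is a Grassmannian $t$-design if $\sum_{j=1}^n P_j^{\otimes t}=\sum_{j=1}^n (UP_jU^*)^{\otimes t}$ for every orthogonal ($\mathbb F=\mathbb R$) or unitary ($\mathbb F=\mathbb C$) $m\times m$ matrix $U$. A $t$-$(m,l,\lambda)$ block design is a collection of $l$-element subsets (blocks) of $\{1,\dots,m\}$ such that every $t$-element subset of $\{1,\dots,m\}$ is contained in exactly $\lambda$ blocks; for $t=2$ it is also called a balanced incomplete block design. **Theorem.** Let $\{\mathcal B_k\}_{k\in K}$, $\mathcal B_k=\{b^{(k)}_j\}_{j=1}^m$,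 be a maximal set of mutually unbiased bases for $\mathbb F^m$, that is, each $\mathcal B_k$ is an orthonormal basis of $\mathbb F^m$, $|\langle b^{(k)}_j,b^{(k')}_{j'}\rangle|^2=\frac1m$ for all $k\ne k'$ and all $j,j'$, and $|K|=k_{\mathbb F}(m)$. Let $\mathbb S$ be a set of subsets of $\{1,\dots,m\}$, all of the same size $l$, and let $P^{(k)}_{\mathcal J}=\sum_{j\in\mathcal J}b^{(k)}_j\otimes (b^{(k)}_j)^*$ for $k\in K$ and $\mathcal J\in\mathbb S$. Suppose that $\mathcal F=\{P^{(k)}_{\mathcal J}:k\in K,\ \mathcal J\in\mathbb S\}$ is a $(2d_{\mathbb F}(m),m/2,m)$-fusion frame. Then $\mathcal F$ is a Grassmannian $2$-design if and only if $\mathbb S$ is a $2$-$(m,m/2,m/2-1)$ block design. -/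

import Mathlib

open scoped Matrix

noncomputable section

open Classical in
/-- The dimension `d_𝔽(m)` of the real space of traceless symmetric (`𝔽 = ℝ`) or Hermitian
(`𝔽 = ℂ`) `m × m` matrices, for `m ≥ 1`. An `RCLike` field is a copy of `ℝ` exactly when its
imaginary unit `RCLike.I` is zero, and a copy of `ℂ` otherwise. The division by `2` is exact. -/
def embedDim (𝕜 : Type*) [RCLike 𝕜] (m : ℕ) : ℕ :=
  if (RCLike.I : 𝕜) = 0 then (m + 2) * (m - 1) / 2 else m ^ 2 - 1

open Classical in
/-- The maximal number `k_𝔽(m)` of mutually unbiased bases: `m/2 + 1` over `ℝ`, `m + 1` over `ℂ`. -/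
def maxMUBCount (𝕜 : Type*) [RCLike 𝕜] (m : ℕ) : ℚ :=
  if (RCLike.I : 𝕜) = 0 then (m : ℚ) / 2 + 1 else (m : ℚ) + 1

theorem embedDim_real (m : ℕ) : embedDim ℝ m = (m + 2) * (m - 1) / 2 := by
  simp [embedDim]

theorem embedDim_complex (m : ℕ) : embedDim ℂ m = m ^ 2 - 1 := by
  simp [embedDim]

theorem maxMUBCount_real (m : ℕ) : maxMUBCount ℝ m = (m : ℚ) / 2 + 1 := by
  simp [maxMUBCount]

theorem maxMUBCount_complex (m : ℕ) : maxMUBCount ℂ m = (m : ℚ) + 1 := by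
  simp [maxMUBCount]

/-- The family `P` is an `(n, l, m)`-fusion frame: it consists of `n` orthogonal projections onto
`l`-dimensional subspaces of `𝕜^m` and satisfies the frame inequalities for some `0 < A ≤ B`. -/
def IsFusionFrame {𝕜 : Type*} [RCLike 𝕜] {ι : Type*} [Fintype ι] (n l m : ℕ)
    (P : ι → Matrix (Fin m) (Fin m) 𝕜) : Prop :=
  Fintype.card ι = n ∧
  (∀ j, IsStarProjection (P j) ∧ (P j).rank = l) ∧
  ∃ A B : ℝ, 0 < A ∧ A ≤ B ∧ ∀ x : EuclideanSpace 𝕜 (Fin m),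
    A * ‖x‖ ^ 2 ≤ ∑ j, ‖Matrix.toEuclideanLin (P j) x‖ ^ 2 ∧
    ∑ j, ‖Matrix.toEuclideanLin (P j) x‖ ^ 2 ≤ B * ‖x‖ ^ 2

/-- The `t`-fold Kronecker power of a square matrix with itself; rows and columns are indexed by
`t`-tuples of indices. -/
def kroneckerPower {𝕜 : Type*} [RCLike 𝕜] {m : ℕ} (t : ℕ) (P : Matrix (Fin m) (Fin m) 𝕜) :
    Matrix (Fin t → Fin m) (Fin t → Fin m) 𝕜 :=
  Matrix.of fun a b => ∏ s, P (a s) (b s)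

/-- `P` is a Grassmannian `t`-design: `∑ P_j^{⊗ t} = ∑ (U P_j U^*)^{⊗ t}` for every unitary
(orthogonal, in the real case) matrix `U`. -/
def IsGrassmannianDesign {𝕜 : Type*} [RCLike 𝕜] {ι : Type*} [Fintype ι] {m : ℕ} (t : ℕ)
    (P : ι → Matrix (Fin m) (Fin m) 𝕜) : Prop :=
  ∀ U ∈ Matrix.unitaryGroup (Fin m) 𝕜,
    ∑ j, kroneckerPower t (P j) = ∑ j, kroneckerPower t (U * P j * Uᴴ)

/-- A family of orthonormal bases of `𝕜^m` that are pairwise mutually unbiased. -/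
def IsMUB {𝕜 : Type*} [RCLike 𝕜] {K : Type*} {m : ℕ}
    (B : K → OrthonormalBasis (Fin m) 𝕜 (EuclideanSpace 𝕜 (Fin m))) : Prop :=
  ∀ k k', k ≠ k' → ∀ j j', ‖inner 𝕜 (B k j) (B k' j')‖ ^ 2 = 1 / (m : ℝ)

/-- A set of mutually unbiased bases that attains the maximal cardinality `k_𝔽(m)`. -/
def IsMaximalMUB {𝕜 : Type*} [RCLike 𝕜] {K : Type*} [Fintype K] {m : ℕ}
    (B : K → OrthonormalBasis (Fin m) 𝕜 (EuclideanSpace 𝕜 (Fin m))) : Prop :=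
  IsMUB B ∧ (Fintype.card K : ℚ) = maxMUBCount 𝕜 m

/-- The `J`-coordinate projection `∑_{j ∈ J} b_j ⊗ b_j^*` with respect to the basis `b`, as a
matrix. -/
def coordProjection {𝕜 : Type*} [RCLike 𝕜] {m : ℕ}
    (b : OrthonormalBasis (Fin m) 𝕜 (EuclideanSpace 𝕜 (Fin m))) (J : Finset (Fin m)) :
    Matrix (Fin m) (Fin m) 𝕜 :=
  ∑ j ∈ J, Matrix.vecMulVec (b j).ofLp (star (b j).ofLp)

/-- `S` is a `t`-`(m, l, lam)` block design on the point set `Fin m`. -/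
def IsBlockDesign (t m l lam : ℕ) (S : Finset (Finset (Fin m))) : Prop :=
  (∀ J ∈ S, J.card = l) ∧
  ∀ T : Finset (Fin m), T.card = t → (S.filter fun J => T ⊆ J).card = lam

end

/-!
Write `M = ∑ P ⊗ P` for the sum over the family. Pairing `M` with `X ⊗ Y` gives the bilinear form
`(X, Y) ↦ ∑ tr (P X) tr (P Y)` (`projectionForm`), and the family is a `2`-design exactly when this
form is invariant under simultaneous conjugation of `X` and `Y` by a unitary matrix
(`isGrassmannianDesign_two_iff`). For coordinate projections the form depends on the block system
`S` only through the numbers `N i j` of blocks containing both `i` and `j`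
(`projectionForm_coordProjection`). Comparing `2 d` with `k` gives `|S| = 2 (m - 1)`.

If the form is invariant, evaluate it at two lines of one of the bases. All other bases are unbiased
to this one and contribute a constant, so the value is `N i j` plus a constant
(`exists_projectionForm_lineProjection_eq`). The unitary matrices that permute the lines of this
basis make `N` invariant under all permutations of the points, and double counting yields
`N i j = m / 2 - 1` for `i ≠ j` (`blockCount_eq_of_perm_invariant`).

If conversely `S` is a block design, double counting gives `N i i = m - 1`, and the form becomes a
combination of `tr X tr Y` and the form of the family of all lines of all bases
(`projectionForm_coordProjection_of_blockCount`). So it remains to see that the lines of a maximal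
set of mutually unbiased bases form a `2`-design. Their second moment `W = ∑ Π ⊗ Π` equals
`I + F` over `ℂ` and `(I + F + T) / 2` over `ℝ`, where `F` is the flip and `T` its partial transpose:
the squared Frobenius norm of the difference expands into the frame potential `∑ |⟨v, w⟩| ^ 4`, the
scalars `⟨Π ⊗ Π, I + F + t T⟩` and `‖I + F + t T‖ ^ 2`, and the maximal number of bases is precisely
what makes the sum vanish (`sum_lineTensor_eq`, `exists_projectionForm_eq_of_isMaximalMUB`).
-/

/-! ### Orthogonal projections onto lines -/

/-- The matrix `v v^*`; for a unit vector `v` it is the orthogonal projection onto the line spanned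
by `v`. -/
def lineProjection {𝕜 : Type*} [RCLike 𝕜] {m : ℕ} (v : EuclideanSpace 𝕜 (Fin m)) :
    Matrix (Fin m) (Fin m) 𝕜 :=
  Matrix.vecMulVec v.ofLp (star v.ofLp)

section

variable {𝕜 : Type*} [RCLike 𝕜] {m : ℕ}

theorem coordProjection_eq_sum (b : OrthonormalBasis (Fin m) 𝕜 (EuclideanSpace 𝕜 (Fin m)))
    (J : Finset (Fin m)) : coordProjection b J = ∑ j ∈ J, lineProjection (b j) := rfl

theorem lineProjection_apply (v : EuclideanSpace 𝕜 (Fin m)) (a c : Fin m) :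
    lineProjection v a c = v a * star (v c) := by
  simp [lineProjection, Matrix.vecMulVec_apply]

theorem star_dotProduct_eq_inner (v w : EuclideanSpace 𝕜 (Fin m)) :
    star v.ofLp ⬝ᵥ w.ofLp = inner 𝕜 v w := by
  rw [EuclideanSpace.inner_eq_star_dotProduct, dotProduct_comm]

theorem trace_lineProjection (v : EuclideanSpace 𝕜 (Fin m)) :
    (lineProjection v).trace = ((‖v‖ ^ 2 : ℝ) : 𝕜) := by
  rw [lineProjection, Matrix.trace_vecMulVec, dotProduct_comm, star_dotProduct_eq_inner,
    inner_self_eq_norm_sq_to_K]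
  push_cast
  rfl

theorem trace_lineProjection_mul (v w : EuclideanSpace 𝕜 (Fin m)) :
    (lineProjection v * lineProjection w).trace = ((‖inner 𝕜 v w‖ ^ 2 : ℝ) : 𝕜) := by
  rw [lineProjection, lineProjection, Matrix.vecMulVec_mul_vecMulVec, Matrix.trace_vecMulVec,
    star_dotProduct_eq_inner, dotProduct_smul, dotProduct_comm, star_dotProduct_eq_inner,
    smul_eq_mul, ← inner_conj_symm w v, RCLike.mul_conj]
  push_cast
  rfl

theorem sum_lineProjection (b : OrthonormalBasis (Fin m) 𝕜 (EuclideanSpace 𝕜 (Fin m))) :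
    ∑ i, lineProjection (b i) = 1 := by
  set V : Matrix (Fin m) (Fin m) 𝕜 := Matrix.of fun a i => b i a with hV
  have h1 : Vᴴ * V = 1 := by
    ext i j
    have := star_dotProduct_eq_inner (b i) (b j)
    rw [b.inner_eq_ite] at this
    rw [Matrix.one_apply, ← this]
    simp [Matrix.mul_apply, dotProduct, hV]
  have h2 : V * Vᴴ = 1 := mul_eq_one_comm.mp h1
  rw [← h2]
  ext a c
  simp [Matrix.sum_apply, lineProjection_apply, Matrix.mul_apply, hV]

theorem trace_lineProjection_mul_self_basis
    (b : OrthonormalBasis (Fin m) 𝕜 (EuclideanSpace 𝕜 (Fin m))) (i j : Fin m) :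
    (lineProjection (b i) * lineProjection (b j)).trace = if i = j then 1 else 0 := by
  rw [trace_lineProjection_mul, b.inner_eq_ite]
  split_ifs <;> simp

theorem trace_coordProjection (b : OrthonormalBasis (Fin m) 𝕜 (EuclideanSpace 𝕜 (Fin m)))
    (J : Finset (Fin m)) : (coordProjection b J).trace = (J.card : 𝕜) := by
  simp [coordProjection_eq_sum, Matrix.trace_sum, trace_lineProjection]

/-- The rank of an idempotent matrix is its trace. -/
theorem rank_eq_trace_of_isIdempotentElem {P : Matrix (Fin m) (Fin m) 𝕜}
    (hP : IsIdempotentElem P) : (P.rank : 𝕜) = P.trace := by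
  have h : IsIdempotentElem (Matrix.toLin' P) := by
    have := Matrix.toLin'_mul P P
    rw [hP.eq] at this
    exact this.symm
  rw [← Matrix.trace_toLin'_eq, (LinearMap.IsIdempotentElem.isProj_range _ h).trace]
  rfl

theorem card_eq_of_isStarProjection_coordProjection
    {b : OrthonormalBasis (Fin m) 𝕜 (EuclideanSpace 𝕜 (Fin m))} {J : Finset (Fin m)} {n : ℕ}
    (h : IsStarProjection (coordProjection b J)) (hn : (coordProjection b J).rank = n) :
    J.card = n := by
  have := rank_eq_trace_of_isIdempotentElem h.isIdempotentElem
  rw [hn, trace_coordProjection] at this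
  exact_mod_cast this.symm

/-- Any permutation of the lines of an orthonormal basis is induced by a unitary matrix. -/
theorem exists_unitary_conj_lineProjection
    (b : OrthonormalBasis (Fin m) 𝕜 (EuclideanSpace 𝕜 (Fin m))) (σ : Equiv.Perm (Fin m)) :
    ∃ U ∈ Matrix.unitaryGroup (Fin m) 𝕜,
      ∀ i, Uᴴ * lineProjection (b i) * U = lineProjection (b (σ i)) := by
  have hb : ∀ i j, star (b i).ofLp ⬝ᵥ (b j).ofLp = if i = j then 1 else 0 := fun i j => by
    rw [star_dotProduct_eq_inner, b.inner_eq_ite]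
  have hs : (∑ i, Matrix.vecMulVec (b i).ofLp (star (b (σ i)).ofLp))ᴴ =
      ∑ i, Matrix.vecMulVec (b (σ i)).ofLp (star (b i).ofLp) := by
    simp [Matrix.conjTranspose_sum, Matrix.conjTranspose_vecMulVec]
  refine ⟨∑ i, Matrix.vecMulVec (b i).ofLp (star (b (σ i)).ofLp), ?_, fun i => ?_⟩
  · rw [Matrix.mem_unitaryGroup_iff, Matrix.star_eq_conjTranspose, hs, ← sum_lineProjection b]
    simp [Finset.sum_mul, Finset.mul_sum, Matrix.vecMulVec_mul_vecMulVec, hb, lineProjection,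
      ite_smul, apply_ite (Matrix.vecMulVec _)]
  · rw [hs]
    simp [Finset.sum_mul, Finset.mul_sum, Matrix.vecMulVec_mul_vecMulVec, hb, lineProjection,
      ite_smul, apply_ite (Matrix.vecMulVec _)]

/-! ### Designs and invariant bilinear forms -/

/-- The bilinear form `(X, Y) ↦ ∑ tr (P_j X) tr (P_j Y)` on matrices, that is, the functional
`X ⊗ Y ↦ tr ((∑ P_j ⊗ P_j) (X ⊗ Y))`. -/
def projectionForm {ι : Type*} [Fintype ι] (P : ι → Matrix (Fin m) (Fin m) 𝕜)
    (X Y : Matrix (Fin m) (Fin m) 𝕜) : 𝕜 :=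
  ∑ p, (P p * X).trace * (P p * Y).trace

theorem sum_sum_mul_sum_sum (f g : Fin m → Fin m → 𝕜) :
    (∑ a, ∑ b, f a b) * ∑ c, ∑ d, g c d = ∑ a, ∑ b, ∑ c, ∑ d, f a b * g c d := by
  simp_rw [Finset.sum_mul]
  simp_rw [Finset.mul_sum]

theorem projectionForm_eq_sum_entries {ι : Type*} [Fintype ι]
    (P : ι → Matrix (Fin m) (Fin m) 𝕜) (X Y : Matrix (Fin m) (Fin m) 𝕜) :
    projectionForm P X Y =
      ∑ a, ∑ b, ∑ c, ∑ d, (∑ p, P p a b * P p c d) * (X b a * Y d c) := by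
  simp only [projectionForm, Matrix.trace, Matrix.diag_apply, Matrix.mul_apply, sum_sum_mul_sum_sum]
  rw [Finset.sum_comm]
  refine Finset.sum_congr rfl fun a _ => ?_
  rw [Finset.sum_comm]
  refine Finset.sum_congr rfl fun b _ => ?_
  rw [Finset.sum_comm]
  refine Finset.sum_congr rfl fun c _ => ?_
  rw [Finset.sum_comm]
  refine Finset.sum_congr rfl fun d _ => ?_
  rw [Finset.sum_mul]
  exact Finset.sum_congr rfl fun p _ => by ring

/-- A family is a `2`-design exactly when its bilinear form is invariant under conjugation. -/
theorem isGrassmannianDesign_two_iff {ι : Type*} [Fintype ι]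
    (P : ι → Matrix (Fin m) (Fin m) 𝕜) :
    IsGrassmannianDesign 2 P ↔ ∀ U ∈ Matrix.unitaryGroup (Fin m) 𝕜, ∀ X Y,
      projectionForm P X Y = projectionForm P (Uᴴ * X * U) (Uᴴ * Y * U) := by
  have hconj : ∀ U X Y, projectionForm P (Uᴴ * X * U) (Uᴴ * Y * U) =
      projectionForm (fun p => U * P p * Uᴴ) X Y := by
    intro U X Y
    have : ∀ p Z, (P p * (Uᴴ * Z * U)).trace = (U * P p * Uᴴ * Z).trace := fun p Z => by
      rw [← Matrix.mul_assoc, ← Matrix.mul_assoc, Matrix.trace_mul_comm]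
      simp only [Matrix.mul_assoc]
    simp only [projectionForm, this]
  simp only [hconj]
  refine forall₂_congr fun U _ => ⟨fun h X Y => ?_, fun h => ?_⟩
  · rw [projectionForm_eq_sum_entries, projectionForm_eq_sum_entries]
    have h' : ∀ a b c d, ∑ p, P p a b * P p c d =
        ∑ p, (U * P p * Uᴴ) a b * (U * P p * Uᴴ) c d := fun a b c d => by
      have := congrFun (congrFun h ![a, c]) ![b, d]
      simpa [Matrix.sum_apply, kroneckerPower, Fin.prod_univ_two] using this
    simp only [h']
  · ext a b
    have := h (Matrix.single (b 0) (a 0) 1) (Matrix.single (b 1) (a 1) 1)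
    simpa [projectionForm, Matrix.trace_mul_single, Matrix.sum_apply, kroneckerPower,
      Fin.prod_univ_two] using this

/-! ### The second moment of a family of unit vectors -/

/-- The entries of `I + F + t T`, where `F` is the flip and `T` its partial transpose. At
`(a, b, c, d)` stands the entry in row `(a, c)` and column `(b, d)`, so that `(a, b)` indexes the
first tensor factor and `(c, d)` the second. -/
def symmetricTensor (t : 𝕜) (q : Fin m × Fin m × Fin m × Fin m) : 𝕜 :=
  (1 : Matrix (Fin m) (Fin m) 𝕜) q.1 q.2.1 * (1 : Matrix (Fin m) (Fin m) 𝕜) q.2.2.1 q.2.2.2 +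
  (1 : Matrix (Fin m) (Fin m) 𝕜) q.1 q.2.2.2 * (1 : Matrix (Fin m) (Fin m) 𝕜) q.2.2.1 q.2.1 +
  t * (1 : Matrix (Fin m) (Fin m) 𝕜) q.1 q.2.2.1 * (1 : Matrix (Fin m) (Fin m) 𝕜) q.2.1 q.2.2.2

/-- The entries of `v v^* ⊗ v v^*`, indexed as in `symmetricTensor`. -/
def lineTensor (v : EuclideanSpace 𝕜 (Fin m)) (q : Fin m × Fin m × Fin m × Fin m) : 𝕜 :=
  lineProjection v q.1 q.2.1 * lineProjection v q.2.2.1 q.2.2.2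

theorem star_lineTensor_dotProduct (v w : EuclideanSpace 𝕜 (Fin m)) :
    star (lineTensor v) ⬝ᵥ lineTensor w = ((‖inner 𝕜 v w‖ ^ 4 : ℝ) : 𝕜) := by
  have h := trace_lineProjection_mul v w
  rw [Matrix.trace_mul_comm] at h
  have h2 : star (lineTensor v) ⬝ᵥ lineTensor w =
      (lineProjection w * lineProjection v).trace * (lineProjection w * lineProjection v).trace := by
    simp only [Matrix.trace, Matrix.diag_apply, Matrix.mul_apply, sum_sum_mul_sum_sum, dotProduct,
      Fintype.sum_prod_type, lineTensor, lineProjection_apply, Pi.star_apply, star_mul', star_star]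
    refine Finset.sum_congr rfl fun a _ => Finset.sum_congr rfl fun b _ =>
      Finset.sum_congr rfl fun c _ => Finset.sum_congr rfl fun d _ => ?_
    ring
  rw [h2, h, ← RCLike.ofReal_mul]
  congr 1
  ring

/-- Pairing with `I + F + t T` contracts the four indices in the three possible ways. -/
theorem dotProduct_symmetricTensor (f : Fin m × Fin m × Fin m × Fin m → 𝕜) (t : 𝕜) :
    f ⬝ᵥ symmetricTensor t =
      ∑ a, ∑ c, (f (a, a, c, c) + f (a, c, c, a) + t * f (a, c, a, c)) := by
  have h : ∀ (p : Prop) [Decidable p] (g : Fin m → 𝕜),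
      ∑ x, (if p then g x else 0) = if p then ∑ x, g x else 0 := fun p _ g => by
    split_ifs <;> simp
  simp only [dotProduct, Fintype.sum_prod_type, symmetricTensor, Matrix.one_apply, mul_add,
    Finset.sum_add_distrib, mul_ite, mul_one, mul_zero, h,
    Finset.sum_ite_eq, Finset.sum_ite_eq', Finset.mem_univ, if_true]
  congr 1
  · congr 1
    refine Finset.sum_congr rfl fun a _ => ?_
    rw [Finset.sum_comm]
    simp only [Finset.sum_ite_eq, Finset.mem_univ, if_true]
  · simp only [mul_comm t]

theorem star_lineTensor_dotProduct_symmetricTensor {t : 𝕜}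
    (ht : t = 0 ∨ t = 1 ∧ ∀ x : 𝕜, star x = x) {v : EuclideanSpace 𝕜 (Fin m)} (hv : ‖v‖ = 1) :
    star (lineTensor v) ⬝ᵥ symmetricTensor t = 2 + t := by
  have h1 : ∑ a, star (v a) * v a = 1 := by
    have := star_dotProduct_eq_inner v v
    rw [inner_self_eq_norm_sq_to_K, hv] at this
    simpa [dotProduct] using this
  have h2 : ∑ a, ∑ c, star (v a) * v a * (star (v c) * v c) = 1 := by
    rw [← Finset.sum_mul_sum, h1, one_mul]
  have h3 : t * ∑ a, ∑ c, star (v a) * v c * (star (v a) * v c) = t := by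
    rcases ht with rfl | ⟨rfl, hs⟩
    · exact zero_mul _
    · rw [one_mul, ← h2]
      simp only [hs]
      exact Finset.sum_congr rfl fun a _ => Finset.sum_congr rfl fun c _ => by ring
  have h4 : ∑ a, ∑ c, star (v a) * v c * (star (v c) * v a) = 1 := by
    rw [← h2]
    exact Finset.sum_congr rfl fun a _ => Finset.sum_congr rfl fun c _ => by ring
  simp only [dotProduct_symmetricTensor, lineTensor, lineProjection_apply, Pi.star_apply,
    star_mul', star_star, Finset.sum_add_distrib, ← Finset.mul_sum, h3, h4, h1, mul_one]
  ring

theorem star_symmetricTensor {t : 𝕜} (ht : t = 0 ∨ t = 1 ∧ ∀ x : 𝕜, star x = x) :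
    star (symmetricTensor (m := m) t) = symmetricTensor t := by
  have ht' : star t = t := by rcases ht with rfl | ⟨rfl, -⟩ <;> simp
  ext q
  simp only [Pi.star_apply, symmetricTensor, star_add, star_mul', ht',
    Matrix.one_apply]
  simp only [apply_ite star, star_one, star_zero]

theorem symmetricTensor_dotProduct_self {t : 𝕜} (ht : t = 0 ∨ t = 1) :
    symmetricTensor (m := m) t ⬝ᵥ symmetricTensor t = (2 + t) * (m * (m + 1 + t)) := by
  have ht' : t * t = t := by rcases ht with rfl | rfl <;> simp
  simp only [dotProduct_symmetricTensor]
  simp only [symmetricTensor, Matrix.one_apply, eq_comm, if_true, mul_add, Finset.sum_add_distrib,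
    mul_ite, mul_one, mul_zero, Finset.sum_ite_eq, Finset.mem_univ,
    Finset.sum_const, Finset.card_univ, Fintype.card_fin, nsmul_eq_mul]
  linear_combination (m : 𝕜) * (m - 1) * ht'

open scoped ComplexOrder in
/-- Equality case of the Welch bound: a family of unit vectors whose frame potential is minimal
has second moment a multiple of `I + F + t T`, as the Frobenius norm of the difference vanishes. -/
theorem sum_lineTensor_eq {ι : Type*} [Fintype ι] {t : 𝕜}
    (ht : t = 0 ∨ t = 1 ∧ ∀ x : 𝕜, star x = x) {v : ι → EuclideanSpace 𝕜 (Fin m)}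
    (hv : ∀ i, ‖v i‖ = 1) (c : ℝ)
    (hcard : (Fintype.card ι : 𝕜) = c * (m * (m + 1 + t)))
    (hpot : ∑ i, ∑ j, ((‖inner 𝕜 (v i) (v j)‖ ^ 4 : ℝ) : 𝕜) = c * (2 + t) * Fintype.card ι) :
    ∑ i, lineTensor (v i) = (c : 𝕜) • symmetricTensor t := by
  have hG : symmetricTensor (m := m) t ⬝ᵥ symmetricTensor t = (2 + t) * (m * (m + 1 + t)) :=
    symmetricTensor_dotProduct_self (ht.imp id And.left)
  have hsG := star_symmetricTensor (m := m) ht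
  have ht' : star t = t := by rcases ht with rfl | ⟨rfl, -⟩ <;> simp
  have hwG : ∀ i, star (lineTensor (v i)) ⬝ᵥ symmetricTensor t = 2 + t := fun i =>
    star_lineTensor_dotProduct_symmetricTensor ht (hv i)
  have hGw : ∀ i, symmetricTensor t ⬝ᵥ lineTensor (v i) = 2 + t := fun i => by
    have := congrArg star (hwG i)
    rw [Matrix.star_dotProduct, star_star, hsG, star_add, ht'] at this
    simpa using this
  rw [← sub_eq_zero, ← dotProduct_star_self_eq_zero]
  simp only [star_sub, star_sum, star_smul, sub_dotProduct, dotProduct_sub, dotProduct_sum,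
    sum_dotProduct, smul_dotProduct, dotProduct_smul, hsG, hG, hwG, hGw,
    star_lineTensor_dotProduct]
  rw [Finset.sum_comm] at hpot
  simp only [Finset.sum_sub_distrib, hpot, Finset.sum_const, Finset.card_univ, nsmul_eq_mul,
    smul_eq_mul, hcard, RCLike.star_def, RCLike.conj_ofReal]
  ring

/-! ### Maximal sets of mutually unbiased bases -/

theorem sum_norm_inner_pow_four_of_isMUB {K : Type*} [Fintype K] (hm : 0 < m)
    {B : K → OrthonormalBasis (Fin m) 𝕜 (EuclideanSpace 𝕜 (Fin m))} (hB : IsMUB B)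
    (k : K) (i : Fin m) :
    ∑ q : K × Fin m, ‖inner 𝕜 (B k i) (B q.1 q.2)‖ ^ 4 = 1 + ((Fintype.card K : ℝ) - 1) / m := by
  classical
  have hm' : (m : ℝ) ≠ 0 := by positivity
  have h : ∀ k', ∑ j, ‖inner 𝕜 (B k i) (B k' j)‖ ^ 4 =
      (1 / m : ℝ) + if k = k' then 1 - (1 / m : ℝ) else 0 := by
    intro k'
    split_ifs with hk
    · subst hk
      simp [(B k).inner_eq_ite, apply_ite norm, ite_pow]
    · have : ∀ j, ‖inner 𝕜 (B k i) (B k' j)‖ ^ 4 = (1 / m : ℝ) ^ 2 := fun j => by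
        rw [← hB k k' hk i j]
        ring
      simp only [this, Finset.sum_const, Finset.card_univ, Fintype.card_fin, nsmul_eq_mul]
      field_simp
      ring
  rw [Fintype.sum_prod_type]
  simp only [h, Finset.sum_add_distrib, Finset.sum_const, Finset.card_univ, nsmul_eq_mul,
    Finset.sum_ite_eq, Finset.mem_univ, if_true]
  ring

theorem star_eq_self_of_I_eq_zero (h : (RCLike.I : 𝕜) = 0) (x : 𝕜) : star x = x := by
  rw [← RCLike.re_add_im x]
  simp [h]

/-- The lines of a maximal set of mutually unbiased bases form a design of order two. In the form
`tr X tr Y + tr (X Y) + t tr (X Yᵀ)` the last term is present (`t = 1`) only over the reals. -/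
theorem exists_projectionForm_eq_of_isMaximalMUB {K : Type*} [Fintype K] (hm : 0 < m)
    {B : K → OrthonormalBasis (Fin m) 𝕜 (EuclideanSpace 𝕜 (Fin m))} (hB : IsMaximalMUB B) :
    ∃ c t : 𝕜, (t = 0 ∨ t = 1 ∧ ∀ x : 𝕜, star x = x) ∧ ∀ X Y,
      projectionForm (fun p : K × Fin m => lineProjection (B p.1 p.2)) X Y =
        c * (X.trace * Y.trace + (X * Y).trace + t * (X * Yᵀ).trace) := by
  obtain ⟨hB, hK⟩ := hB
  have hm' : (m : ℝ) ≠ 0 := by positivity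
  -- The constant `c` is forced by the trace of the second moment, which counts the lines.
  obtain ⟨c, t, ht, hcard, hpot⟩ : ∃ c t : ℝ, (t = 0 ∨ t = 1 ∧ ∀ x : 𝕜, star x = x) ∧
      (Fintype.card K : ℝ) = c * (m + 1 + t) ∧
      1 + ((Fintype.card K : ℝ) - 1) / m = c * (2 + t) := by
    by_cases hI : (RCLike.I : 𝕜) = 0
    · have hK' : (Fintype.card K : ℝ) = m / 2 + 1 := by
        rw [maxMUBCount, if_pos hI] at hK
        rw [← Rat.cast_natCast, hK]
        push_cast
        rfl
      refine ⟨1 / 2, 1, Or.inr ⟨rfl, star_eq_self_of_I_eq_zero hI⟩, ?_, ?_⟩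
      · rw [hK']; ring
      · rw [hK']; field_simp; ring
    · have hK' : (Fintype.card K : ℝ) = m + 1 := by
        rw [maxMUBCount, if_neg hI] at hK
        exact_mod_cast hK
      refine ⟨1, 0, Or.inl rfl, ?_, ?_⟩
      · rw [hK']; ring
      · rw [hK']; field_simp; ring
  have ht' : (t : 𝕜) = 0 ∨ (t : 𝕜) = 1 ∧ ∀ x : 𝕜, star x = x := by
    rcases ht with rfl | ⟨rfl, h⟩
    · simp
    · exact Or.inr ⟨by simp, h⟩
  refine ⟨c, t, ht', fun X Y => ?_⟩
  have key := sum_lineTensor_eq (ι := K × Fin m) ht' (v := fun p => B p.1 p.2)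
    (fun p => (B p.1).orthonormal.1 p.2) c
    (by
      have : ((Fintype.card K * m : ℝ) : 𝕜) = ((c * (m + 1 + t) * m : ℝ) : 𝕜) := by rw [hcard]
      rw [Fintype.card_prod, Fintype.card_fin]
      push_cast at this ⊢
      rw [this]
      ring)
    (by
      simp only [← RCLike.ofReal_sum, sum_norm_inner_pow_four_of_isMUB hm hB, hpot, Finset.sum_const,
        Finset.card_univ, nsmul_eq_mul]
      push_cast
      ring)
  have hent : ∀ a b d e, ∑ p : K × Fin m, lineProjection (B p.1 p.2) a b *
      lineProjection (B p.1 p.2) d e = (c : 𝕜) * symmetricTensor (t : 𝕜) (a, b, d, e) :=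
    fun a b d e => by
      have := congrFun key (a, b, d, e)
      simpa [lineTensor, Finset.sum_apply] using this
  have h2 := dotProduct_symmetricTensor
    (fun q : Fin m × Fin m × Fin m × Fin m => X q.2.1 q.1 * Y q.2.2.2 q.2.2.1) (t : 𝕜)
  rw [projectionForm_eq_sum_entries]
  simp only [hent]
  have h3 : X.trace * Y.trace + (X * Y).trace + (t : 𝕜) * (X * Yᵀ).trace =
      ∑ a, ∑ b, (X a a * Y b b + X b a * Y a b + t * (X b a * Y b a)) := by
    simp only [Finset.sum_add_distrib, ← Finset.mul_sum]
    congr 1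
    · congr 1
      · rw [Matrix.trace, Matrix.trace, Finset.sum_mul_sum]
        simp only [Matrix.diag_apply, Finset.mul_sum]
      · simp only [Matrix.trace, Matrix.diag_apply, Matrix.mul_apply]
        exact Finset.sum_comm
    · congr 1
      simp only [Matrix.trace, Matrix.diag_apply, Matrix.mul_apply, Matrix.transpose_apply]
      exact Finset.sum_comm
  rw [h3, ← h2]
  simp only [dotProduct, Fintype.sum_prod_type, Finset.mul_sum]
  refine Finset.sum_congr rfl fun a _ => Finset.sum_congr rfl fun b _ =>
    Finset.sum_congr rfl fun d _ => Finset.sum_congr rfl fun e _ => ?_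
  ring

/-! ### Invariance under unitary conjugation -/

theorem trace_conj_unitary {U : Matrix (Fin m) (Fin m) 𝕜} (hU : U ∈ Matrix.unitaryGroup (Fin m) 𝕜)
    (X : Matrix (Fin m) (Fin m) 𝕜) : (Uᴴ * X * U).trace = X.trace := by
  rw [Matrix.trace_mul_comm, ← Matrix.mul_assoc, ← Matrix.star_eq_conjTranspose,
    Matrix.mem_unitaryGroup_iff.mp hU, Matrix.one_mul]

theorem conj_unitary_mul {U : Matrix (Fin m) (Fin m) 𝕜} (hU : U ∈ Matrix.unitaryGroup (Fin m) 𝕜)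
    (X Y : Matrix (Fin m) (Fin m) 𝕜) :
    (Uᴴ * X * U) * (Uᴴ * Y * U) = Uᴴ * (X * Y) * U := by
  have h : U * Uᴴ = 1 := Matrix.mem_unitaryGroup_iff.mp hU
  calc (Uᴴ * X * U) * (Uᴴ * Y * U) = Uᴴ * X * (U * Uᴴ) * Y * U := by simp only [Matrix.mul_assoc]
    _ = _ := by rw [h, Matrix.mul_one]; simp only [Matrix.mul_assoc]

theorem transpose_conj_of_star_eq_self (hs : ∀ x : 𝕜, star x = x)
    (U Y : Matrix (Fin m) (Fin m) 𝕜) : (Uᴴ * Y * U)ᵀ = Uᴴ * Yᵀ * U := by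
  have h : Uᴴ = Uᵀ := by
    ext i j
    simp [Matrix.conjTranspose_apply, hs]
  rw [h]
  simp [Matrix.transpose_mul, Matrix.mul_assoc]

/-! ### Counting blocks through a pair of points -/

/-- The number of members of `S` that contain both `i` and `j`; for `i = j` this is the number of
members through the point `i`. -/
def blockCount (S : Finset (Finset (Fin m))) (i j : Fin m) : ℕ :=
  (S.filter fun J => {i, j} ⊆ J).card

theorem blockCount_eq_sum (S : Finset (Finset (Fin m))) (i j : Fin m) :
    blockCount S i j = ∑ J ∈ S, (if i ∈ J then 1 else 0) * (if j ∈ J then 1 else 0) := by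
  rw [blockCount, Finset.card_filter]
  refine Finset.sum_congr rfl fun J _ => ?_
  simp [Finset.insert_subset_iff, ← ite_and, and_comm]

theorem sum_blockCount_self {S : Finset (Finset (Fin m))} {l : ℕ} (hS : ∀ J ∈ S, J.card = l) :
    ∑ i, blockCount S i i = S.card * l := by
  simp only [blockCount_eq_sum]
  rw [Finset.sum_comm, Finset.sum_const_nat (m := l)]
  intro J hJ
  simp [hS J hJ]

theorem sum_blockCount {S : Finset (Finset (Fin m))} {l : ℕ} (hS : ∀ J ∈ S, J.card = l)
    (i : Fin m) : ∑ j, blockCount S i j = blockCount S i i * l := by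
  simp only [blockCount_eq_sum]
  rw [Finset.sum_comm, Finset.sum_mul]
  refine Finset.sum_congr rfl fun J hJ => ?_
  rw [← Finset.mul_sum]
  split_ifs <;> simp [hS J hJ]

theorem isBlockDesign_two_iff {S : Finset (Finset (Fin m))} {l lam : ℕ}
    (hS : ∀ J ∈ S, J.card = l) :
    IsBlockDesign 2 m l lam S ↔ ∀ i j, i ≠ j → blockCount S i j = lam := by
  refine ⟨fun h i j hij => h.2 _ (Finset.card_pair hij), fun h => ⟨hS, fun T hT => ?_⟩⟩
  obtain ⟨i, j, hij, rfl⟩ := Finset.card_eq_two.mp hT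
  exact h i j hij

/-- If `2 (m - 1)` blocks of size `m / 2` have symmetric incidence, every pair of points lies in
`m / 2 - 1` of them. -/
theorem blockCount_eq_of_perm_invariant {h : ℕ} (hh : m = 2 * h) (hpos : 0 < h)
    {S : Finset (Finset (Fin m))} (hS : ∀ J ∈ S, J.card = h) (hcard : S.card = 2 * (m - 1))
    (hinv : ∀ (σ : Equiv.Perm (Fin m)) i j, blockCount S (σ i) (σ j) = blockCount S i j)
    {i j : Fin m} (hij : i ≠ j) : blockCount S i j = h - 1 := by
  have hr : blockCount S i i = m - 1 := by
    have h1 := sum_blockCount_self hS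
    have h2 : ∀ x, blockCount S x x = blockCount S i i := fun x => by
      simpa using hinv (Equiv.swap i x) i i
    simp only [h2, Finset.sum_const, Finset.card_univ, Fintype.card_fin, smul_eq_mul, hcard] at h1
    refine Nat.eq_of_mul_eq_mul_left (show 0 < m by omega) ?_
    rw [h1]
    nth_rewrite 2 [hh]
    ring
  have h1 := sum_blockCount hS i
  have h2 : ∀ x ∈ Finset.univ.erase i, blockCount S i x = blockCount S i j := fun x hx => by
    have := hinv (Equiv.swap j x) i j
    rwa [Equiv.swap_apply_of_ne_of_ne hij (Finset.ne_of_mem_erase hx).symm,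
      Equiv.swap_apply_left] at this
  rw [← Finset.add_sum_erase _ _ (Finset.mem_univ i), Finset.sum_congr rfl h2, hr] at h1
  simp only [Finset.sum_const, Finset.card_erase_of_mem (Finset.mem_univ i), Finset.card_univ,
    Fintype.card_fin, smul_eq_mul] at h1
  refine Nat.eq_of_mul_eq_mul_left (show 0 < m - 1 by omega) ?_
  rw [Nat.mul_sub, mul_one]
  omega

/-- If every pair of points lies in `m / 2 - 1` blocks, every point lies in `m - 1` blocks. -/
theorem blockCount_self_eq {h : ℕ} (hh : m = 2 * h) (hpos : 0 < h)
    {S : Finset (Finset (Fin m))} (hS : ∀ J ∈ S, J.card = h) (hcard : S.card = 2 * (m - 1))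
    (hpair : ∀ i j, i ≠ j → blockCount S i j = h - 1) (i : Fin m) :
    blockCount S i i = m - 1 := by
  rcases Nat.lt_or_ge 1 h with h1 | h1
  · have h2 := sum_blockCount hS i
    rw [← Finset.add_sum_erase _ _ (Finset.mem_univ i), Finset.sum_congr rfl
      (fun x hx => hpair i x (Finset.ne_of_mem_erase hx).symm)] at h2
    simp only [Finset.sum_const, Finset.card_erase_of_mem (Finset.mem_univ i), Finset.card_univ,
      Fintype.card_fin, smul_eq_mul] at h2
    refine Nat.eq_of_mul_eq_mul_right (show 0 < h - 1 by omega) ?_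
    rw [Nat.mul_sub, mul_one]
    omega
  -- For `m = 2` pairs carry no information, but then `S` consists of both singletons.
  · obtain rfl : h = 1 := by omega
    obtain rfl : m = 2 := by omega
    have hsub : S ⊆ Finset.univ.powersetCard 1 := fun J hJ => by
      simp [Finset.mem_powersetCard, hS J hJ]
    rw [Finset.eq_of_subset_of_card_le hsub (by rw [hcard]; decide)]
    revert i
    decide

/-- The number of blocks, from the number `2 d` of projections and the number `k` of bases. -/
theorem card_eq_of_card_prod {K : Type*} [Fintype K] {h : ℕ} (hh : m = 2 * h) (hpos : 0 < h)
    {S : Finset (Finset (Fin m))} (hK : (Fintype.card K : ℚ) = maxMUBCount 𝕜 m)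
    (hcard : Fintype.card (K × S) = 2 * embedDim 𝕜 m) : S.card = 2 * (m - 1) := by
  rw [Fintype.card_prod, Fintype.card_coe] at hcard
  obtain ⟨n, rfl⟩ : ∃ n, h = n + 1 := ⟨h - 1, by omega⟩
  have hm1 : m - 1 = 2 * n + 1 := by omega
  by_cases hI : (RCLike.I : 𝕜) = 0
  · rw [maxMUBCount, if_pos hI, hh] at hK
    have hK' : Fintype.card K = n + 2 := by
      have : (Fintype.card K : ℚ) = ((n + 2 : ℕ) : ℚ) := by rw [hK]; push_cast; ring
      exact_mod_cast this
    have hd : (m + 2) * (m - 1) / 2 = (n + 2) * (2 * n + 1) := by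
      rw [hm1, hh, show (2 * (n + 1) + 2) * (2 * n + 1) = 2 * ((n + 2) * (2 * n + 1)) by ring]
      simp
    rw [embedDim, if_pos hI, hd, hK'] at hcard
    rw [hm1]
    refine Nat.eq_of_mul_eq_mul_left (show 0 < n + 2 by omega) ?_
    rw [hcard]
    ring
  · rw [maxMUBCount, if_neg hI, hh] at hK
    have hK' : Fintype.card K = 2 * n + 3 := by
      have : (Fintype.card K : ℚ) = ((2 * n + 3 : ℕ) : ℚ) := by rw [hK]; push_cast; ring
      exact_mod_cast this
    have hd : m ^ 2 - 1 = (2 * n + 3) * (2 * n + 1) := by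
      rw [hh, show (2 * (n + 1)) ^ 2 = (2 * n + 3) * (2 * n + 1) + 1 by ring]
      simp
    rw [embedDim, if_neg hI, hd, hK'] at hcard
    rw [hm1]
    refine Nat.eq_of_mul_eq_mul_left (show 0 < 2 * n + 3 by omega) ?_
    rw [hcard]
    ring

/-! ### Coordinate projections along a block system -/

/-- The bilinear form of the coordinate projections sees the block system only through the number
of blocks containing each pair of points. -/
theorem projectionForm_coordProjection {K : Type*} [Fintype K]
    (B : K → OrthonormalBasis (Fin m) 𝕜 (EuclideanSpace 𝕜 (Fin m)))
    (S : Finset (Finset (Fin m))) (X Y : Matrix (Fin m) (Fin m) 𝕜) :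
    projectionForm (fun p : K × S => coordProjection (B p.1) p.2.1) X Y =
      ∑ k, ∑ i, ∑ j, (blockCount S i j : 𝕜) *
        ((lineProjection (B k i) * X).trace * (lineProjection (B k j) * Y).trace) := by
  rw [projectionForm, Fintype.sum_prod_type]
  refine Finset.sum_congr rfl fun k _ => ?_
  rw [Finset.sum_coe_sort S fun J =>
    (coordProjection (B k) J * X).trace * (coordProjection (B k) J * Y).trace]
  have h : ∀ J Z, (coordProjection (B k) J * Z).trace =
      ∑ i, (if i ∈ J then 1 else 0) * (lineProjection (B k i) * Z).trace := fun J Z => by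
    simp [coordProjection_eq_sum, Finset.sum_mul, Matrix.trace_sum]
  simp only [h, Finset.sum_mul_sum]
  rw [Finset.sum_comm]
  refine Finset.sum_congr rfl fun i _ => ?_
  rw [Finset.sum_comm]
  refine Finset.sum_congr rfl fun j _ => ?_
  rw [blockCount_eq_sum]
  push_cast
  rw [Finset.sum_mul]
  exact Finset.sum_congr rfl fun J _ => by ring

/-- On two lines of the same basis, the form is the pair count up to a constant: the other bases,
being unbiased, contribute the same for all pairs. -/
theorem exists_projectionForm_lineProjection_eq {K : Type*} [Fintype K]
    {B : K → OrthonormalBasis (Fin m) 𝕜 (EuclideanSpace 𝕜 (Fin m))} (hB : IsMUB B)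
    (S : Finset (Finset (Fin m))) (k : K) :
    ∃ C : 𝕜, ∀ i j, projectionForm (fun p : K × S => coordProjection (B p.1) p.2.1)
      (lineProjection (B k i)) (lineProjection (B k j)) = blockCount S i j + C := by
  classical
  refine ⟨∑ k' ∈ Finset.univ.erase k, ∑ i, ∑ j, (blockCount S i j : 𝕜) *
    (((1 / m : ℝ) : 𝕜) * ((1 / m : ℝ) : 𝕜)), fun i j => ?_⟩
  rw [projectionForm_coordProjection, ← Finset.add_sum_erase _ _ (Finset.mem_univ k)]
  congr 1
  · simp [trace_lineProjection_mul_self_basis]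
  · refine Finset.sum_congr rfl fun k' hk' => ?_
    simp only [trace_lineProjection_mul, hB k' k (Finset.ne_of_mem_erase hk')]

/-- A system of blocks of constant pair counts turns each basis into a combination of its lines
and the identity. -/
theorem projectionForm_coordProjection_of_blockCount {K : Type*} [Fintype K]
    (B : K → OrthonormalBasis (Fin m) 𝕜 (EuclideanSpace 𝕜 (Fin m)))
    {S : Finset (Finset (Fin m))} {r lam : ℕ} (hr : ∀ i, blockCount S i i = r)
    (hlam : ∀ i j, i ≠ j → blockCount S i j = lam) (X Y : Matrix (Fin m) (Fin m) 𝕜) :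
    projectionForm (fun p : K × S => coordProjection (B p.1) p.2.1) X Y =
      (r - lam) * projectionForm (fun p : K × Fin m => lineProjection (B p.1 p.2)) X Y +
        Fintype.card K * lam * (X.trace * Y.trace) := by
  have hN : ∀ i j, (blockCount S i j : 𝕜) = (if i = j then (r - lam : 𝕜) else 0) + lam := by
    intro i j
    split_ifs with hij
    · rw [hij, hr]; ring
    · rw [hlam i j hij]; ring
  have htr : ∀ k (Z : Matrix (Fin m) (Fin m) 𝕜),
      ∑ i, (lineProjection (B k i) * Z).trace = Z.trace := fun k Z => by
    rw [← Matrix.trace_sum, ← Finset.sum_mul, sum_lineProjection, Matrix.one_mul]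
  rw [projectionForm_coordProjection, projectionForm, Fintype.sum_prod_type]
  have hk : ∀ k, ∑ i, ∑ j, (blockCount S i j : 𝕜) *
      ((lineProjection (B k i) * X).trace * (lineProjection (B k j) * Y).trace) =
      (r - lam) * ∑ i, (lineProjection (B k i) * X).trace * (lineProjection (B k i) * Y).trace +
        lam * (X.trace * Y.trace) := fun k => by
    simp only [hN, add_mul, Finset.sum_add_distrib, ite_mul, zero_mul, Finset.sum_ite_eq,
      Finset.mem_univ, if_true, ← Finset.mul_sum]
    rw [← Finset.sum_mul, htr, htr]
  simp only [hk, Finset.sum_add_distrib, ← Finset.mul_sum, Finset.sum_const, Finset.card_univ,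
    nsmul_eq_mul]
  ring

end

theorem mainTheorem4 {𝕜 : Type*} [RCLike 𝕜] {m l : ℕ} (hm : 0 < m) (hmeven : Even m)
    {K : Type*} [Fintype K]
    (B : K → OrthonormalBasis (Fin m) 𝕜 (EuclideanSpace 𝕜 (Fin m)))
    (hB : IsMaximalMUB B)
    (S : Finset (Finset (Fin m))) (hS : ∀ J ∈ S, J.card = l)
    (hF : IsFusionFrame (2 * embedDim 𝕜 m) (m / 2) m
      (fun p : K × S => coordProjection (B p.1) p.2.1)) :
    IsGrassmannianDesign 2 (fun p : K × S => coordProjection (B p.1) p.2.1) ↔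
      IsBlockDesign 2 m (m / 2) (m / 2 - 1) S := by
  obtain ⟨h, hh⟩ : ∃ h, m = 2 * h := hmeven.two_dvd
  have hpos : 0 < h := by omega
  have hdiv : m / 2 = h := by omega
  have hne : Nonempty K := by
    rw [← Fintype.card_pos_iff, ← Nat.cast_pos (α := ℚ), hB.2, maxMUBCount]
    split_ifs <;> positivity
  obtain ⟨k⟩ := hne
  have hcard : S.card = 2 * (m - 1) := card_eq_of_card_prod hh hpos hB.2 hF.1
  rw [hdiv] at hF ⊢
  have hSh : ∀ J ∈ S, J.card = h := fun J hJ =>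
    have := hF.2.1 (k, ⟨J, hJ⟩)
    card_eq_of_isStarProjection_coordProjection this.1 this.2
  rw [isGrassmannianDesign_two_iff, isBlockDesign_two_iff hSh]
  constructor
  -- A design has an invariant form, so the pair counts are invariant under all permutations.
  · intro hdes i j hij
    refine blockCount_eq_of_perm_invariant hh hpos hSh hcard (fun σ i j => ?_) hij
    obtain ⟨U, hU, hUσ⟩ := exists_unitary_conj_lineProjection (B k) σ
    obtain ⟨C, hC⟩ := exists_projectionForm_lineProjection_eq hB.1 S k
    have := hdes U hU (lineProjection (B k i)) (lineProjection (B k j))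
    rw [hUσ, hUσ, hC, hC, add_left_inj] at this
    exact_mod_cast this.symm
  -- The form of a block design is a combination of that of all the lines and of `tr X tr Y`.
  · intro hpair U hU X Y
    obtain ⟨c, t, ht, hform⟩ := exists_projectionForm_eq_of_isMaximalMUB hm hB
    have hr := blockCount_self_eq hh hpos hSh hcard hpair
    rw [projectionForm_coordProjection_of_blockCount B hr hpair,
      projectionForm_coordProjection_of_blockCount B hr hpair, hform, hform,
      conj_unitary_mul hU, trace_conj_unitary hU, trace_conj_unitary hU, trace_conj_unitary hU]
    rcases ht with rfl | ⟨rfl, hs⟩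
    · simp only [zero_mul]
    · rw [transpose_conj_of_star_eq_self hs, conj_unitary_mul hU, trace_conj_unitary hU]
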